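/- All algebras have the form $\mathbf L=\langle L,\wedge,\vee,{}',{}^{\sim},0,1\rangle$, of type $\langle 2,2,1,1,0,0\rangle$; put $\Diamond x=x^{\sim\sim}$ and $\Box x=x'^{\sim}$. Such an algebra is a *PBZ\*-lattice* if $\langle L,\wedge,\vee,0,1\rangle$ is a bounded lattice with an order-reversing involution ${}'$ and, for all $a,b\in L$: $a\wedge a'\le b\vee b'$; $a\wedge a^{\sim}=0$; $a\le a^{\sim\sim}$; $a\le b$ implies $b^{\sim}\le a^{\sim}$; $a^{\sim\prime}=a^{\sim\sim}$; $(a\wedge a')^{\sim}\le a^{\sim}\vee a'^{\sim}$; and if $a\le b$ and $a'\wedge b=0$ then $a=b$. An *antiortholattice* is a PBZ\*-lattice with $\{a\in L: a\wedge a'=0\}=\{0,1\}$; $\mathbb{AOL}$ is the class of all antiortholattices. Let $\mathbf D_3$ be the antiortholattice on the chain $0<a<1$ with $0'=1$, $a'=a$, $1'=0$, $0^{\sim}=1$, $a^{\sim}=1^{\sim}=0$. For a class $\mathbb K$ of algebras, $V(\mathbb K)$ is the smallest class containing $\mathbb K$ and closed under homomorphic images, subalgebras (up to isomorphism) and direct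 products, and $Eq(\mathbb K)$ is the set of identities valid in $\mathbb K$; for a set $E$ of identities, $Mod(E)$ is the class of all algebras satisfying $E$. An inequality $s\le t$ stands for the identity $s\wedge t\approx s$. Consider $$\text{(DIST)}\ x\wedge(y\vee z)\approx(x\wedge y)\vee(x\wedge z),\qquad \text{(SDM)}\ (x\wedge y)^{\sim}\approx x^{\sim}\vee y^{\sim},\qquad \text{(SK)}\ x\wedge\Diamond y\le\Box x\vee y .$$ **Corollary 3.15.** $V(\mathbf D_3)=Mod\bigl(Eq(\mathbb{AOL})\cup\{\mathrm{SK}\}\bigr)$. Thus $V(\mathbf D_3)$ is axiomatised relative to $V(\mathbb{AOL})$ by the single identity SK, that is, $V(\mathbf D_3)=\{\mathbf L\in V(\mathbb{AOL}):\mathbf L\text{ satisfies SK}\}$, and every $\mathbf L\in V(\mathbb{AOL})$ that satisfies SK also satisfies DIST and SDM. -/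

import Mathlib

universe u

namespace PBZ

/-- The operations of an algebra of type `⟨2,2,1,1,0,0⟩`: meet `⊓`, join `⊔`, the involution
`kneg x` (written `x'`), the Brouwer complement `bneg x` (written `x^∼`), and the constants
`⊥` (`0`) and `⊤` (`1`). No laws are imposed. -/
class BZOps (A : Type u) extends Min A, Max A, Bot A, Top A where
  kneg : A → A
  bneg : A → A

section Ops

variable {A : Type u} [BZOps A]

/-- The involution `x'`. -/
abbrev kneg (x : A) : A := BZOps.kneg x

/-- The Brouwer complement `x^∼`. -/
abbrev bneg (x : A) : A := BZOps.bneg x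

/-- `◇x = x^∼∼`. -/
def dia (x : A) : A := bneg (bneg x)

/-- `□x = x'^∼`. -/
def box (x : A) : A := bneg (kneg x)

/-- The lattice order `x ≤ y`, that is, `x ∧ y = x`. -/
def Below (x y : A) : Prop := x ⊓ y = x

end Ops

/-- Algebras of type `⟨2,2,1,1,0,0⟩`. -/
structure Alg : Type (u + 1) where
  carrier : Type u
  [ops : BZOps carrier]

attribute [instance] Alg.ops

instance : CoeSort Alg.{u} (Type u) := ⟨Alg.carrier⟩

/-- Bounded lattices with an order-reversing involution. -/
structure IsBoundedInvolutionLattice (A : Alg.{u}) : Prop where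
  inf_comm : ∀ a b : A, a ⊓ b = b ⊓ a
  sup_comm : ∀ a b : A, a ⊔ b = b ⊔ a
  inf_assoc : ∀ a b c : A, a ⊓ b ⊓ c = a ⊓ (b ⊓ c)
  sup_assoc : ∀ a b c : A, a ⊔ b ⊔ c = a ⊔ (b ⊔ c)
  inf_sup_self : ∀ a b : A, a ⊓ (a ⊔ b) = a
  sup_inf_self : ∀ a b : A, a ⊔ (a ⊓ b) = a
  bot_below : ∀ a : A, Below ⊥ a
  below_top : ∀ a : A, Below a ⊤
  kneg_kneg : ∀ a : A, kneg (kneg a) = a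
  kneg_antitone : ∀ a b : A, Below a b → Below (kneg b) (kneg a)

/-- Pseudo-Kleene algebras. -/
structure IsPseudoKleene (A : Alg.{u}) : Prop extends IsBoundedInvolutionLattice A where
  kleene : ∀ a b : A, Below (a ⊓ kneg a) (b ⊔ kneg b)

/-- Brouwer–Zadeh lattices. -/
structure IsBZLattice (A : Alg.{u}) : Prop extends IsPseudoKleene A where
  inf_bneg : ∀ a : A, a ⊓ bneg a = ⊥
  below_dia : ∀ a : A, Below a (bneg (bneg a))
  bneg_antitone : ∀ a b : A, Below a b → Below (bneg b) (bneg a)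
  kneg_bneg : ∀ a : A, kneg (bneg a) = bneg (bneg a)

/-- PBZ*-lattices: paraorthomodular BZ-lattices satisfying the condition `(∗)`. -/
structure IsPBZStarLattice (A : Alg.{u}) : Prop extends IsBZLattice A where
  star : ∀ a : A, Below (bneg (a ⊓ kneg a)) (bneg a ⊔ bneg (kneg a))
  paraorthomodular : ∀ a b : A, Below a b → kneg a ⊓ b = ⊥ → a = b

/-- The set of Kleene-sharp elements. -/
def sharp (A : Alg.{u}) : Set A := {a | a ⊓ kneg a = ⊥}

/-- The class `𝔸𝕆𝕃` of antiortholattices. -/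
def AOL : Set Alg.{u} := {A | IsPBZStarLattice A ∧ sharp A = {⊥, ⊤}}

/-- The `n`-element Kleene chain `D_n` (`n ≥ 1`), with the order-reversing involution of the chain
and with `0^∼ = 1`, `a^∼ = 0` for `a > 0`. The underlying set `{0, …, n-1}` is lifted to an
arbitrary universe. -/
def D (n : ℕ) [NeZero n] : Alg.{u} where
  carrier := ULift.{u} (Fin n)
  ops :=
    { min := fun x y => ⟨min x.down y.down⟩
      max := fun x y => ⟨max x.down y.down⟩
      bot := ⟨0⟩
      top := ⟨Fin.rev 0⟩
      kneg := fun x => ⟨x.down.rev⟩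
      bneg := fun x => ⟨if x.down = 0 then Fin.rev 0 else 0⟩ }

/-- Homomorphisms: maps preserving all six operations. -/
structure IsHom {A B : Alg.{u}} (f : A → B) : Prop where
  map_inf : ∀ x y, f (x ⊓ y) = f x ⊓ f y
  map_sup : ∀ x y, f (x ⊔ y) = f x ⊔ f y
  map_kneg : ∀ x, f (kneg x) = kneg (f x)
  map_bneg : ∀ x, f (bneg x) = bneg (f x)
  map_bot : f ⊥ = ⊥
  map_top : f ⊤ = ⊤

/-- Direct products, with componentwise operations. -/
def Alg.prod {I : Type u} (A : I → Alg.{u}) : Alg.{u} where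
  carrier := ∀ i, A i
  ops :=
    { min := fun x y i => x i ⊓ y i
      max := fun x y i => x i ⊔ y i
      bot := fun _ => ⊥
      top := fun _ => ⊤
      kneg := fun x i => kneg (x i)
      bneg := fun x i => bneg (x i) }

/-- A variety: a class of algebras closed under homomorphic images, under (isomorphic copies of)
subalgebras, and under arbitrary direct products. -/
structure IsVariety (W : Set Alg.{u}) : Prop where
  image : ∀ (A B : Alg.{u}) (f : A → B), IsHom f → Function.Surjective f → A ∈ W → B ∈ W
  sub : ∀ (A B : Alg.{u}) (f : B → A), IsHom f → Function.Injective f → A ∈ W → B ∈ W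
  prod : ∀ (I : Type u) (A : I → Alg.{u}), (∀ i, A i ∈ W) → Alg.prod A ∈ W

/-- `V(K)`, the variety generated by `K`: the smallest variety containing `K`. -/
def V (K : Set Alg.{u}) : Set Alg.{u} := {A | ∀ W : Set Alg.{u}, IsVariety W → K ⊆ W → A ∈ W}

/-- Terms of the type `⟨2,2,1,1,0,0⟩` in countably many variables. -/
inductive Term : Type
  | var (n : ℕ)
  | meet (s t : Term)
  | join (s t : Term)
  | kneg (t : Term)
  | bneg (t : Term)
  | zero
  | one

/-- The term algebra; it lets terms be written with the usual symbols. -/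
instance : BZOps Term where
  min := Term.meet
  max := Term.join
  bot := Term.zero
  top := Term.one
  kneg := Term.kneg
  bneg := Term.bneg

/-- The value of a term under an assignment of the variables. -/
def Term.eval {A : Type u} [BZOps A] (v : ℕ → A) : Term → A
  | var n => v n
  | meet s t => s.eval v ⊓ t.eval v
  | join s t => s.eval v ⊔ t.eval v
  | kneg t => PBZ.kneg (t.eval v)
  | bneg t => PBZ.bneg (t.eval v)
  | zero => ⊥
  | one => ⊤

/-- An identity `lhs ≈ rhs`. -/
structure Identity : Type where
  lhs : Term
  rhs : Term

/-- The algebra `A` satisfies an identity. -/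
def Satisfies (A : Alg.{u}) (e : Identity) : Prop :=
  ∀ v : ℕ → A, e.lhs.eval v = e.rhs.eval v

/-- `Eq(K)`: the set of all identities valid in every member of `K`. -/
def identities (K : Set Alg.{u}) : Set Identity := {e | ∀ A ∈ K, Satisfies A e}

/-- `Mod(E)`: the class of all algebras satisfying every identity in `E`. -/
def models (E : Set Identity) : Set Alg.{u} := {A | ∀ e ∈ E, Satisfies A e}

/-- The inequality `s ≤ t` as the identity `s ∧ t ≈ s`. -/
def Identity.le (s t : Term) : Identity := ⟨s ⊓ t, s⟩

/-- The variable `x`. -/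
def tx : Term := .var 0

/-- The variable `y`. -/
def ty : Term := .var 1

/-- The variable `z`. -/
def tz : Term := .var 2

/-- `x ∧ (y ∨ z) ≈ (x ∧ y) ∨ (x ∧ z)`. -/
def DIST : Identity := ⟨tx ⊓ (ty ⊔ tz), (tx ⊓ ty) ⊔ (tx ⊓ tz)⟩

/-- `(x ∧ y)^∼ ≈ x^∼ ∨ y^∼`. -/
def SDM : Identity := ⟨bneg (tx ⊓ ty), bneg tx ⊔ bneg ty⟩

/-- `x ∧ ◇y ≤ □x ∨ y`. -/
def SK : Identity := .le (tx ⊓ dia ty) (box tx ⊔ ty)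

end PBZ

/-!
In an antiortholattice `x^∼` is `1` for `x = 0` and `0` otherwise, so every identity expressing that
the elements `x^∼` are complemented, central and form a Boolean subalgebra holds in `𝔸𝕆𝕃`, hence in
every model `A` of `Eq(𝔸𝕆𝕃)`. `IsStarCentral` collects the instances of this that are needed.

If `A` moreover satisfies SK, then `x ∧ ◇y ≤ □x ∨ y` gives two things.

* SDM (`IsStarCentral.bneg_inf`): relative to the closed element
  `e = (x ∧ y)^∼ ∧ ◇x ∧ ◇y`, the elements `u = x ∧ e` and `v = y ∧ e` are disjoint and have the same
  closure `e`, and SK forces such elements to be `0`. Hence `◇` and `□` are lattice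
  homomorphisms onto the Boolean algebra of closed elements.
* Elements are determined by their modal bounds (`IsStarCentral.eq_of_dia_eq_of_box_eq`): if
  `◇x = ◇y` and `□x = □y` then `x = x ∧ ◇y ≤ □x ∨ y = y`, and symmetrically. In particular `A` is
  distributive.

A prime ideal `P` of `A` therefore induces a homomorphism `A → D₃` sending `x` to `1` if `□x ∉ P`, to
`a` if `□x ∈ P` and `◇x ∉ P`, and to `0` if `◇x ∈ P` (`IsStarCentral.isHom_toD`). By the prime ideal
theorem these homomorphisms separate points, so `A` embeds in a power of `D₃`
(`IsStarCentral.mem_V_D`); neither Birkhoff's theorem nor Jónsson's lemma is needed. Everything else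
follows from the validity of identities being preserved under homomorphic images, subalgebras and
products.
-/

namespace PBZ

/-! ### Varieties and identities -/

theorem IsHom.map_eval {A B : Alg.{u}} {f : A → B} (hf : IsHom f) (v : ℕ → A) (t : Term) :
    f (t.eval v) = t.eval (fun n => f (v n)) := by
  induction t with
  | var n => rfl
  | meet s t hs ht => exact (hf.map_inf _ _).trans (by rw [hs, ht]; rfl)
  | join s t hs ht => exact (hf.map_sup _ _).trans (by rw [hs, ht]; rfl)
  | kneg t ht => exact (hf.map_kneg _).trans (by rw [ht]; rfl)
  | bneg t ht => exact (hf.map_bneg _).trans (by rw [ht]; rfl)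
  | zero => exact hf.map_bot
  | one => exact hf.map_top

theorem isHom_proj {I : Type u} (A : I → Alg.{u}) (i : I) :
    IsHom (A := Alg.prod A) (B := A i) (fun x => x i) :=
  ⟨fun _ _ => rfl, fun _ _ => rfl, fun _ => rfl, fun _ => rfl, rfl, rfl⟩

theorem isVariety_models (E : Set Identity) : IsVariety (models.{u} E) where
  image A B f hf hs hA e he v := by
    choose g hg using hs
    have h := congrArg f (hA e he (fun n => g (v n)))
    simpa only [hf.map_eval, hg] using h
  sub A B f hf hi hA e he v := hi (by
    rw [hf.map_eval, hf.map_eval]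
    exact hA e he _)
  prod I A hA e he v := funext fun i => by
    have h := hA i e he (fun n => v n i)
    rwa [← (isHom_proj A i).map_eval v, ← (isHom_proj A i).map_eval v] at h

theorem V_subset_models {K : Set Alg.{u}} {E : Set Identity} (h : K ⊆ models E) :
    V K ⊆ models E :=
  fun _ hA => hA _ (isVariety_models E) h

theorem subset_models_identities (K : Set Alg.{u}) : K ⊆ models (identities K) :=
  fun _ hA _ he => he _ hA

theorem V_mono {K K' : Set Alg.{u}} (h : K ⊆ V K') : V K ⊆ V K' :=
  fun _ hA W hW hK => hA W hW fun _ hB => h hB W hW hK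

/-! ### The lattice reduct -/

/-- The Mathlib lattice structure on a bounded involution lattice; its operations are definitionally
those of the algebra. -/
abbrev IsBoundedInvolutionLattice.lattice {A : Alg.{u}} (h : IsBoundedInvolutionLattice A) :
    Lattice A :=
  Lattice.mk' h.sup_comm h.sup_assoc h.inf_comm h.inf_assoc h.sup_inf_self h.inf_sup_self

/-- The bounds of a bounded involution lattice, as a `BoundedOrder`. -/
abbrev IsBoundedInvolutionLattice.boundedOrder {A : Alg.{u}} (h : IsBoundedInvolutionLattice A) :
    letI := h.lattice
    BoundedOrder A :=
  letI := h.lattice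
  { bot_le := fun a => inf_eq_left.1 (h.bot_below a)
    le_top := fun a => inf_eq_left.1 (h.below_top a) }

theorem IsBoundedInvolutionLattice.kneg_inf {A : Alg.{u}} (h : IsBoundedInvolutionLattice A)
    (x y : A) : kneg (x ⊓ y) = kneg x ⊔ kneg y := by
  let := h.lattice
  have anti : ∀ {a b : A}, a ≤ b → kneg b ≤ kneg a := fun hab =>
    inf_eq_left.1 (h.kneg_antitone _ _ (inf_eq_left.2 hab))
  apply le_antisymm
  · have h1 : kneg (kneg x ⊔ kneg y) ≤ x := by
      simpa only [h.kneg_kneg] using anti (le_sup_left : kneg x ≤ kneg x ⊔ kneg y)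
    have h2 : kneg (kneg x ⊔ kneg y) ≤ y := by
      simpa only [h.kneg_kneg] using anti (le_sup_right : kneg y ≤ kneg x ⊔ kneg y)
    simpa only [h.kneg_kneg] using anti (le_inf h1 h2)
  · exact sup_le (anti inf_le_left) (anti inf_le_right)

theorem IsBoundedInvolutionLattice.kneg_sup {A : Alg.{u}} (h : IsBoundedInvolutionLattice A)
    (x y : A) : kneg (x ⊔ y) = kneg x ⊓ kneg y := by
  rw [← h.kneg_kneg (kneg x ⊓ kneg y), h.kneg_inf, h.kneg_kneg, h.kneg_kneg]

theorem IsBoundedInvolutionLattice.kneg_bot {A : Alg.{u}} (h : IsBoundedInvolutionLattice A) :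
    kneg (⊥ : A) = ⊤ := by
  let := h.lattice
  let := h.boundedOrder
  have := inf_eq_left.1 (h.kneg_antitone _ _ (h.bot_below (kneg (⊤ : A))))
  rw [h.kneg_kneg] at this
  exact top_le_iff.1 this

/-! ### Antiortholattices -/

section AOL

variable {B : Alg.{u}}

theorem bneg_bot_of_mem_AOL (hB : B ∈ AOL) : bneg (⊥ : B) = ⊤ := by
  have h := hB.1
  let := h.lattice
  let := h.boundedOrder
  have h0 : bneg (⊤ : B) = ⊥ := by simpa using h.inf_bneg (⊤ : B)
  have h1 := inf_eq_left.1 (h.below_dia (⊤ : B))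
  rw [h0] at h1
  exact top_le_iff.1 h1

theorem bneg_of_mem_AOL (hB : B ∈ AOL) {x : B} (hx : x ≠ ⊥) : bneg x = ⊥ := by
  have h := hB.1
  let := h.lattice
  let := h.boundedOrder
  have hs : bneg x ∈ sharp B := by
    change bneg x ⊓ kneg (bneg x) = ⊥
    rw [h.kneg_bneg, h.inf_bneg]
  rw [hB.2] at hs
  rcases hs with hs | hs
  · exact hs
  · refine absurd ?_ hx
    have := h.inf_bneg x
    rw [Set.mem_singleton_iff.1 hs] at this
    simpa using this

end AOL

/-! ### Algebras with central Brouwer complements -/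

/-- Bounded involution lattices in which the elements `x^∼` are complemented (with complement
`◇x`), form a distributive sublattice and behave as central elements. All clauses are identities
valid in every antiortholattice. -/
structure IsStarCentral (A : Alg.{u}) : Prop extends IsBoundedInvolutionLattice A where
  bneg_bot : bneg (⊥ : A) = ⊤
  bneg_top : bneg (⊤ : A) = ⊥
  kneg_bneg : ∀ x : A, kneg (bneg x) = dia x
  dia_bneg : ∀ x : A, dia (bneg x) = bneg x
  inf_dia : ∀ x : A, x ⊓ dia x = x
  box_inf : ∀ x : A, box x ⊓ x = box x
  bneg_sup : ∀ x y : A, bneg (x ⊔ y) = bneg x ⊓ bneg y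
  dia_inf_bneg : ∀ x y : A, dia (x ⊓ bneg y) = dia x ⊓ bneg y
  dia_sup_bneg_self : ∀ x : A, dia x ⊔ bneg x = ⊤
  dia_inf_bneg_self : ∀ x : A, dia x ⊓ bneg x = ⊥
  bneg_distrib : ∀ x y z : A,
    bneg x ⊓ (bneg y ⊔ bneg z) = (bneg x ⊓ bneg y) ⊔ (bneg x ⊓ bneg z)
  split : ∀ x y : A, (x ⊓ bneg y) ⊔ (x ⊓ dia y) = x
  cancel : ∀ x y : A, (bneg y ⊔ x) ⊓ dia y ⊓ x = (bneg y ⊔ x) ⊓ dia y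

theorem isStarCentral_of_mem_AOL {B : Alg.{u}} (hB : B ∈ AOL) : IsStarCentral B := by
  have h := hB.1
  let := h.lattice
  let := h.boundedOrder
  have h0 := bneg_bot_of_mem_AOL hB
  have h1 : bneg (⊤ : B) = ⊥ := by simpa using h.inf_bneg (⊤ : B)
  -- Every identity is checked separately for zero and nonzero arguments of the Brouwer complement.
  have hc : ∀ x : B, x = ⊥ ∨ bneg x = ⊥ := fun x =>
    or_iff_not_imp_left.2 (bneg_of_mem_AOL hB)
  have hcd : ∀ x : B, (bneg x = ⊥ ∨ bneg x = ⊤) := fun x => by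
    rcases hc x with hx | hx
    · exact Or.inr (by rw [hx, h0])
    · exact Or.inl hx
  have hd : ∀ x : B, dia x = bneg (bneg x) := fun _ => rfl
  exact
  { h.toIsBoundedInvolutionLattice with
    bneg_bot := h0
    bneg_top := h1
    kneg_bneg := h.kneg_bneg
    dia_bneg := fun x => by rcases hcd x with hx | hx <;> simp only [hd, hx, h0, h1]
    inf_dia := h.below_dia
    box_inf := fun x => by
      have hx : box x = bneg (kneg x) := rfl
      rcases hc (kneg x) with hk | hk
      · rw [← h.kneg_kneg x, hk, h.kneg_bot]
        exact inf_top_eq _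
      · rw [hx, hk]
        exact bot_inf_eq _
    bneg_sup := fun x y => by
      rcases hc x with hx | hx
      · rw [hx, h0, bot_sup_eq, top_inf_eq]
      · by_cases hxy : x ⊔ y = ⊥
        · rw [(sup_eq_bot_iff.1 hxy).1, h0, bot_sup_eq, top_inf_eq]
        · rw [hx, bneg_of_mem_AOL hB hxy, bot_inf_eq]
    dia_inf_bneg := fun x y => by
      rcases hcd y with hy | hy <;> simp [hd, hy, h0, h1]
    dia_sup_bneg_self := fun x => by
      rcases hcd x with hx | hx <;> simp [hd, hx, h0]
    dia_inf_bneg_self := fun x => by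
      rcases hcd x with hx | hx <;> simp [hd, hx, h1]
    bneg_distrib := fun x y z => by
      rcases hcd x with hx | hx <;> simp [hx]
    split := fun x y => by
      rcases hcd y with hy | hy <;> simp [hd, hy, h0, h1]
    cancel := fun x y => by
      rcases hcd y with hy | hy <;> simp [hd, hy, h0, h1] }

/-- The assignment of `x`, `y`, `z` to the first three variables. -/
def assign {A : Type u} (x y z : A) : ℕ → A
  | 0 => x
  | 1 => y
  | _ => z

theorem isStarCentral_of_mem_models {A : Alg.{u}} (hA : A ∈ models (identities AOL.{u})) :
    IsStarCentral A := by
  have tr : ∀ s t : Term, (∀ B : Alg.{u}, IsStarCentral B → Satisfies B ⟨s, t⟩) →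
      ∀ x y z : A, s.eval (assign x y z) = t.eval (assign x y z) :=
    fun s t h x y z => hA ⟨s, t⟩ (fun B hB => h B (isStarCentral_of_mem_AOL hB)) _
  have inf_comm : ∀ a b : A, a ⊓ b = b ⊓ a := fun a b =>
    tr (tx ⊓ ty) (ty ⊓ tx) (fun B h v => h.inf_comm (v 0) (v 1)) a b a
  have kneg_inf : ∀ a b : A, kneg (a ⊓ b) = kneg a ⊔ kneg b := fun a b =>
    tr (kneg (tx ⊓ ty)) (kneg tx ⊔ kneg ty) (fun B h v => h.kneg_inf (v 0) (v 1)) a b a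
  have inf_sup_self : ∀ a b : A, a ⊓ (a ⊔ b) = a := fun a b =>
    tr (tx ⊓ (tx ⊔ ty)) tx (fun B h v => h.inf_sup_self (v 0) (v 1)) a b a
  have sup_comm : ∀ a b : A, a ⊔ b = b ⊔ a := fun a b =>
    tr (tx ⊔ ty) (ty ⊔ tx) (fun B h v => h.sup_comm (v 0) (v 1)) a b a
  exact
  { inf_comm := inf_comm
    sup_comm := sup_comm
    inf_sup_self := inf_sup_self
    inf_assoc := tr (tx ⊓ ty ⊓ tz) (tx ⊓ (ty ⊓ tz)) fun B h v => h.inf_assoc (v 0) (v 1) (v 2)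
    sup_assoc := tr (tx ⊔ ty ⊔ tz) (tx ⊔ (ty ⊔ tz)) fun B h v => h.sup_assoc (v 0) (v 1) (v 2)
    sup_inf_self := fun a b =>
      tr (tx ⊔ (tx ⊓ ty)) tx (fun B h v => h.sup_inf_self (v 0) (v 1)) a b a
    bot_below := fun a => tr (⊥ ⊓ tx) ⊥ (fun B h v => h.bot_below (v 0)) a a a
    below_top := fun a => tr (tx ⊓ ⊤) tx (fun B h v => h.below_top (v 0)) a a a
    kneg_kneg := fun a => tr (kneg (kneg tx)) tx (fun B h v => h.kneg_kneg (v 0)) a a a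
    kneg_antitone := fun a b hab => by
      change kneg b ⊓ kneg a = kneg b
      rw [show kneg a = kneg b ⊔ kneg a by
        rw [sup_comm, ← kneg_inf, show a ⊓ b = a from hab], inf_sup_self]
    bneg_bot := tr (bneg ⊥) ⊤ (fun B h v => h.bneg_bot) ⊥ ⊥ ⊥
    bneg_top := tr (bneg ⊤) ⊥ (fun B h v => h.bneg_top) ⊥ ⊥ ⊥
    kneg_bneg := fun a => tr (kneg (bneg tx)) (dia tx) (fun B h v => h.kneg_bneg (v 0)) a a a
    dia_bneg := fun a => tr (dia (bneg tx)) (bneg tx) (fun B h v => h.dia_bneg (v 0)) a a a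
    inf_dia := fun a => tr (tx ⊓ dia tx) tx (fun B h v => h.inf_dia (v 0)) a a a
    box_inf := fun a => tr (box tx ⊓ tx) (box tx) (fun B h v => h.box_inf (v 0)) a a a
    bneg_sup := fun a b =>
      tr (bneg (tx ⊔ ty)) (bneg tx ⊓ bneg ty) (fun B h v => h.bneg_sup (v 0) (v 1)) a b a
    dia_inf_bneg := fun a b =>
      tr (dia (tx ⊓ bneg ty)) (dia tx ⊓ bneg ty) (fun B h v => h.dia_inf_bneg (v 0) (v 1)) a b a
    dia_sup_bneg_self := fun a =>
      tr (dia tx ⊔ bneg tx) ⊤ (fun B h v => h.dia_sup_bneg_self (v 0)) a a a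
    dia_inf_bneg_self := fun a =>
      tr (dia tx ⊓ bneg tx) ⊥ (fun B h v => h.dia_inf_bneg_self (v 0)) a a a
    bneg_distrib := tr (bneg tx ⊓ (bneg ty ⊔ bneg tz)) ((bneg tx ⊓ bneg ty) ⊔ (bneg tx ⊓ bneg tz))
      fun B h v => h.bneg_distrib (v 0) (v 1) (v 2)
    split := fun a b =>
      tr ((tx ⊓ bneg ty) ⊔ (tx ⊓ dia ty)) tx (fun B h v => h.split (v 0) (v 1)) a b a
    cancel := fun a b =>
      tr ((bneg ty ⊔ tx) ⊓ dia ty ⊓ tx) ((bneg ty ⊔ tx) ⊓ dia ty)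
        (fun B h v => h.cancel (v 0) (v 1)) a b a }

namespace IsStarCentral

variable {A : Alg.{u}}

theorem bneg_inf_of_le (h : IsStarCentral A) {x y : A} (hxy : x ⊔ y = y) :
    bneg y ⊓ bneg x = bneg y := by
  rw [h.inf_comm, ← h.bneg_sup, hxy]

/-! ### Consequences of SK -/

/-- Two disjoint elements with the same closure vanish, in the presence of SK: SK makes each of
them closed, so they coincide. -/
theorem dia_eq_bot_of_disjoint (h : IsStarCentral A) (sk : Satisfies A SK) {u v : A}
    (huv : u ⊓ v = ⊥) (hd : dia u = dia v) : dia u = ⊥ := by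
  let := h.lattice
  let := h.boundedOrder
  have key : ∀ {u v : A}, u ⊓ v = ⊥ → dia u = dia v → dia u ≤ u := by
    intro u v huv hd
    have h1 : u ≤ box u ⊔ v := by
      have := sk (assign u v v)
      change (u ⊓ dia v) ⊓ (box u ⊔ v) = u ⊓ dia v at this
      rw [← hd, h.inf_dia] at this
      exact inf_eq_left.1 this
    have h2 : u ⊓ dia (kneg u) ≤ v :=
      (inf_le_inf_right _ h1).trans (inf_eq_left.1 (h.cancel v (kneg u)))
    have h3 : u ⊓ dia (kneg u) = ⊥ := le_bot_iff.1 (huv ▸ le_inf inf_le_left h2)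
    have h4 : u ⊓ box u = u := by
      have := h.split u (kneg u)
      rwa [h3, sup_bot_eq] at this
    have h5 : u = box u := le_antisymm (inf_eq_left.1 h4) (inf_eq_left.1 (h.box_inf u))
    have h6 : dia u = u := by
      rw [h5]
      exact h.dia_bneg (kneg u)
    exact h6.le
  have hu := key huv hd
  have hv := key (v := u) (by rw [h.inf_comm, huv]) hd.symm
  exact le_bot_iff.1 (huv ▸ le_inf hu (hd ▸ hv))

/-- SK implies the strong De Morgan law in algebras with central Brouwer complements. -/
theorem bneg_inf (h : IsStarCentral A) (sk : Satisfies A SK) (x y : A) :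
    bneg (x ⊓ y) = bneg x ⊔ bneg y := by
  let := h.lattice
  let := h.boundedOrder
  -- The closed element `z^∼` measures the failure of the law.
  obtain ⟨z, hz⟩ : ∃ z : A, bneg z = bneg (x ⊓ y) ⊓ (dia x ⊓ dia y) :=
    ⟨(x ⊓ y) ⊔ (bneg x ⊔ bneg y), by rw [h.bneg_sup, h.bneg_sup]; rfl⟩
  have hzx : dia x ⊓ bneg z = bneg z := inf_eq_right.2 (by
    rw [hz]; exact inf_le_right.trans inf_le_left)
  have hzy : dia y ⊓ bneg z = bneg z := inf_eq_right.2 (by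
    rw [hz]; exact inf_le_right.trans inf_le_right)
  have hdisj : ∀ w : A, w ⊓ bneg w = ⊥ := fun w => le_bot_iff.1 (by
    rw [← h.dia_inf_bneg_self w]
    exact inf_le_inf_right _ (inf_eq_left.1 (h.inf_dia w)))
  have huv : (x ⊓ bneg z) ⊓ (y ⊓ bneg z) = ⊥ := le_bot_iff.1 (by
    rw [← hdisj (x ⊓ y)]
    exact le_inf (inf_le_inf inf_le_left inf_le_left)
      (inf_le_left.trans (inf_le_right.trans (hz.le.trans inf_le_left))))
  have hbot : bneg z = ⊥ := by
    have := h.dia_eq_bot_of_disjoint sk huv (by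
      rw [h.dia_inf_bneg, h.dia_inf_bneg, hzx, hzy])
    rwa [h.dia_inf_bneg, hzx] at this
  have htop : dia (x ⊓ y) ⊔ (bneg x ⊔ bneg y) = ⊤ := by
    have h2 : kneg (bneg (x ⊓ y) ⊓ (dia x ⊓ dia y)) = ⊤ := by
      rw [← hz, hbot, h.kneg_bot]
    rw [h.kneg_inf, h.kneg_inf, h.kneg_bneg] at h2
    have h3 : ∀ w : A, kneg (dia w) = bneg w := fun w => by
      rw [← h.kneg_bneg, h.kneg_kneg]
    rwa [h3, h3] at h2
  have anti : ∀ {a b : A}, a ≤ b → bneg b ≤ bneg a := fun hab =>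
    inf_eq_left.1 (h.bneg_inf_of_le (sup_eq_right.2 hab))
  apply le_antisymm
  · -- The right-hand side is closed, so the distributive law for closed elements applies to it.
    have hcl : bneg (kneg (bneg x ⊔ bneg y)) = bneg x ⊔ bneg y := by
      have h3 : kneg (bneg x ⊔ bneg y) = bneg (bneg x ⊔ bneg y) := by
        rw [h.kneg_sup, h.bneg_sup, h.kneg_bneg, h.kneg_bneg]; rfl
      rw [h3]
      exact (h.kneg_bneg _).symm.trans (by rw [← h3, h.kneg_kneg])
    have hd := h.bneg_distrib (x ⊓ y) (bneg (x ⊓ y)) (kneg (bneg x ⊔ bneg y))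
    rw [hcl] at hd
    change bneg (x ⊓ y) ⊓ (dia (x ⊓ y) ⊔ (bneg x ⊔ bneg y))
      = bneg (x ⊓ y) ⊓ dia (x ⊓ y) ⊔ bneg (x ⊓ y) ⊓ (bneg x ⊔ bneg y) at hd
    rw [htop, inf_top_eq, h.inf_comm _ (dia _), h.dia_inf_bneg_self, bot_sup_eq] at hd
    exact inf_eq_left.1 hd.symm
  · exact sup_le (anti inf_le_left) (anti inf_le_right)

theorem dia_sup (h : IsStarCentral A) (sk : Satisfies A SK) (x y : A) :
    dia (x ⊔ y) = dia x ⊔ dia y := by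
  change bneg (bneg (x ⊔ y)) = bneg (bneg x) ⊔ bneg (bneg y)
  rw [h.bneg_sup, h.bneg_inf sk]

theorem dia_inf (h : IsStarCentral A) (sk : Satisfies A SK) (x y : A) :
    dia (x ⊓ y) = dia x ⊓ dia y := by
  change bneg (bneg (x ⊓ y)) = bneg (bneg x) ⊓ bneg (bneg y)
  rw [h.bneg_inf sk, h.bneg_sup]

theorem box_sup (h : IsStarCentral A) (sk : Satisfies A SK) (x y : A) :
    box (x ⊔ y) = box x ⊔ box y := by
  change bneg (kneg (x ⊔ y)) = bneg (kneg x) ⊔ bneg (kneg y)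
  rw [h.kneg_sup, h.bneg_inf sk]

theorem box_inf_eq (h : IsStarCentral A) (x y : A) : box (x ⊓ y) = box x ⊓ box y := by
  change bneg (kneg (x ⊓ y)) = bneg (kneg x) ⊓ bneg (kneg y)
  rw [h.kneg_inf, h.bneg_sup]

theorem box_bneg (h : IsStarCentral A) (x : A) : box (bneg x) = bneg x := by
  change bneg (kneg (bneg x)) = bneg x
  rw [h.kneg_bneg]
  exact h.dia_bneg x

/-- Under SK an element is determined by its possibility and its necessity. -/
theorem eq_of_dia_eq_of_box_eq (h : IsStarCentral A) (sk : Satisfies A SK) {x y : A}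
    (hd : dia x = dia y) (hb : box x = box y) : x = y := by
  let := h.lattice
  have key : ∀ {x y : A}, dia x = dia y → box x = box y → x ≤ y := by
    intro x y hd hb
    have := sk (assign x y y)
    change (x ⊓ dia y) ⊓ (box x ⊔ y) = x ⊓ dia y at this
    rw [← hd, h.inf_dia, hb, sup_eq_right.2 (inf_eq_left.1 (h.box_inf y))] at this
    exact inf_eq_left.1 this
  exact le_antisymm (key hd hb) (key hd.symm hb.symm)

theorem inf_sup_distrib (h : IsStarCentral A) (sk : Satisfies A SK) (x y z : A) :
    x ⊓ (y ⊔ z) = (x ⊓ y) ⊔ (x ⊓ z) := by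
  apply h.eq_of_dia_eq_of_box_eq sk
  · rw [h.dia_inf sk, h.dia_sup sk, h.dia_sup sk, h.dia_inf sk, h.dia_inf sk]
    exact h.bneg_distrib _ _ _
  · rw [h.box_inf_eq, h.box_sup sk, h.box_sup sk, h.box_inf_eq, h.box_inf_eq]
    exact h.bneg_distrib _ _ _

/-- The distributive lattice structure forced by SK. -/
abbrev distribLattice (h : IsStarCentral A) (sk : Satisfies A SK) : DistribLattice A :=
  letI := h.lattice
  DistribLattice.ofInfSupLe fun x y z => (h.inf_sup_distrib sk x y z).le

end IsStarCentral

/-! ### Homomorphisms to the three-element chain -/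

open Classical in
/-- The element of `D₃` that is top if `p` fails, the middle one if only `q` fails, and bottom
otherwise; it is used for `q → p`. -/
noncomputable def level (p q : Prop) : D.{u} 3 :=
  ULift.up (if p then if q then 0 else 1 else 2)

theorem level_or {p q p' q' : Prop} (h : q → p) (h' : q' → p') :
    level (p ∨ p') (q ∨ q') = level p q ⊓ level p' q' := by
  by_cases p <;> by_cases q <;> by_cases p' <;> by_cases q' <;> simp_all [level] <;> rfl

theorem level_and {p q p' q' : Prop} (h : q → p) (h' : q' → p') :
    level (p ∧ p') (q ∧ q') = level p q ⊔ level p' q' := by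
  by_cases p <;> by_cases q <;> by_cases p' <;> by_cases q' <;> simp_all [level] <;> rfl

theorem level_not {p q : Prop} (h : q → p) : level (¬ q) (¬ p) = kneg (level p q) := by
  by_cases p <;> by_cases q <;> simp_all [level] <;> rfl

theorem level_not_not {p q : Prop} (h : q → p) : level (¬ q) (¬ q) = bneg (level p q) := by
  by_cases p <;> by_cases q <;> simp_all [level] <;> rfl

/-- The map to `D₃` induced by a set `P` (a prime ideal in the applications): `x` goes to the top
element if `□x ∉ P`, to the middle one if only `◇x ∉ P`, and to the bottom one otherwise. -/
noncomputable def toD {A : Alg.{u}} (P : Set A) (x : A) : D.{u} 3 :=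
  level (box x ∈ P) (dia x ∈ P)

theorem toD_eq_iff {A : Alg.{u}} {P : Set A} {x y : A} (hx : dia x ∈ P → box x ∈ P)
    (hy : dia y ∈ P → box y ∈ P) (hxy : toD P x = toD P y) :
    (box x ∈ P ↔ box y ∈ P) ∧ (dia x ∈ P ↔ dia y ∈ P) := by
  have := congrArg ULift.down hxy
  simp only [toD, level] at this
  split_ifs at this <;> simp_all

namespace IsStarCentral

variable {A : Alg.{u}}

theorem isHom_toD (h : IsStarCentral A) (sk : Satisfies A SK) {P : Set A}
    (hbot : ⊥ ∈ P) (htop : ⊤ ∉ P) (hsup : ∀ x y : A, x ⊔ y ∈ P ↔ x ∈ P ∧ y ∈ P)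
    (hinf : ∀ x y : A, x ⊓ y ∈ P ↔ x ∈ P ∨ y ∈ P) : IsHom (toD P) := by
  have hbd : ∀ x : A, dia x ∈ P → box x ∈ P := fun x hx => by
    have h1 : box x ⊓ dia x = box x := by
      rw [← h.box_inf x, h.inf_assoc, h.inf_dia]
    rw [← h1, hinf]
    exact Or.inr hx
  have hcompl : ∀ x : A, bneg x ∈ P ↔ dia x ∉ P := fun x => by
    have h1 := (hinf (dia x) (bneg x)).1 (by rwa [h.dia_inf_bneg_self])
    have h2 := mt (hsup (dia x) (bneg x)).2 (by rwa [h.dia_sup_bneg_self])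
    tauto
  have hk : ∀ x : A, dia (kneg x) ∈ P ↔ box x ∉ P := fun x => by
    have : box x ∈ P ↔ dia (kneg x) ∉ P := hcompl (kneg x)
    tauto
  have hk' : ∀ x : A, box (kneg x) ∈ P ↔ dia x ∉ P := fun x => by
    have : box (kneg x) = bneg x := congrArg bneg (h.kneg_kneg x)
    rw [this, hcompl]
  constructor
  · intro x y
    simp only [toD, h.box_inf_eq, h.dia_inf sk, hinf]
    exact level_or (hbd x) (hbd y)
  · intro x y
    simp only [toD, h.box_sup sk, h.dia_sup sk, hsup]
    exact level_and (hbd x) (hbd y)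
  · intro x
    simp only [toD, hk, hk']
    exact level_not (hbd x)
  · intro x
    simp only [toD, h.box_bneg, h.dia_bneg, hcompl]
    exact level_not_not (hbd x)
  · have h1 : dia (⊥ : A) = ⊥ := (congrArg bneg h.bneg_bot).trans h.bneg_top
    have h2 : box (⊥ : A) = ⊥ := (congrArg bneg h.kneg_bot).trans h.bneg_top
    simp only [toD, h1, h2, hbot, level, if_true]
    rfl
  · have h1 : box (⊤ : A) = ⊤ := by
      have : kneg (⊤ : A) = ⊥ := by rw [← h.kneg_bot, h.kneg_kneg]
      exact (congrArg bneg this).trans h.bneg_bot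
    simp only [toD, h1, htop, level, if_false]
    rfl

theorem toD_separates (h : IsStarCentral A) (sk : Satisfies A SK) {x y : A} (hxy : x ≠ y) :
    ∃ f : A → D.{u} 3, IsHom f ∧ f x ≠ f y := by
  let := h.distribLattice sk
  let : BoundedOrder A := h.boundedOrder
  -- Disjointness of the principal filter and ideal is all the prime ideal theorem asks for.
  have sep : ∀ a b : A, ¬ a ≤ b → ∃ P : Order.Ideal A, P.IsPrime ∧ b ∈ P ∧ a ∉ P := by
    intro a b hab
    obtain ⟨P, hP, hb, ha⟩ := DistribLattice.prime_ideal_of_disjoint_filter_ideal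
      (F := Order.PFilter.principal a) (I := Order.Ideal.principal b)
      (Set.disjoint_left.2 fun c hc hc' => hab (le_trans hc hc'))
    exact ⟨P, hP, hb (Order.Ideal.mem_principal.2 le_rfl),
      fun haP => Set.disjoint_left.1 ha (Order.PFilter.mem_principal.2 le_rfl) haP⟩
  have sep' : ∀ a b : A, a ≠ b → ∃ P : Order.Ideal A, P.IsPrime ∧ ¬ (a ∈ P ↔ b ∈ P) := by
    intro a b hab
    by_cases hle : a ≤ b
    · obtain ⟨P, hP, h1, h2⟩ := sep b a fun hba => hab (le_antisymm hle hba)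
      exact ⟨P, hP, by tauto⟩
    · obtain ⟨P, hP, h1, h2⟩ := sep a b hle
      exact ⟨P, hP, by tauto⟩
  obtain ⟨P, hP, hne⟩ : ∃ P : Order.Ideal A, P.IsPrime ∧
      ¬ ((box x ∈ P ↔ box y ∈ P) ∧ (dia x ∈ P ↔ dia y ∈ P)) := by
    by_cases hd : dia x = dia y
    · obtain ⟨P, hP, hne⟩ := sep' _ _ fun hb => hxy (h.eq_of_dia_eq_of_box_eq sk hd hb)
      exact ⟨P, hP, by tauto⟩
    · obtain ⟨P, hP, hne⟩ := sep' _ _ hd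
      exact ⟨P, hP, by tauto⟩
  have hbd : ∀ x : A, dia x ∈ P → box x ∈ P := fun x hx =>
    P.lower ((inf_eq_left.1 (h.box_inf x)).trans (inf_eq_left.1 (h.inf_dia x))) hx
  refine ⟨toD P, h.isHom_toD sk P.bot_mem hP.toIsProper.top_notMem (fun a b => Order.Ideal.sup_mem_iff)
    (fun a b => ⟨hP.mem_or_mem, ?_⟩), fun he => hne (toD_eq_iff (hbd x) (hbd y) he)⟩
  rintro (ha | hb)
  · exact P.lower inf_le_left ha
  · exact P.lower inf_le_right hb

/-- An algebra with central Brouwer complements satisfying SK embeds in a power of `D₃`. -/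
theorem mem_V_D (h : IsStarCentral A) (sk : Satisfies A SK) : A ∈ V {D.{u} 3} := by
  intro W hW hD
  let I := {f : A → D.{u} 3 // IsHom f}
  refine hW.sub (Alg.prod fun _ : I => D.{u} 3) A (fun x f => f.1 x) ?_ ?_
    (hW.prod _ _ fun _ => hD rfl)
  · exact ⟨fun x y => funext fun f => f.2.map_inf x y, fun x y => funext fun f => f.2.map_sup x y,
      fun x => funext fun f => f.2.map_kneg x, fun x => funext fun f => f.2.map_bneg x,
      funext fun f => f.2.map_bot, funext fun f => f.2.map_top⟩
  · intro x y hxy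
    by_contra hne
    obtain ⟨f, hf, hfne⟩ := h.toD_separates sk hne
    exact hfne (congrFun hxy ⟨f, hf⟩)

end IsStarCentral

/-! ### The three-element chain -/

theorem forall_D {p : D.{u} 3 → Prop} : (∀ x, p x) ↔ ∀ i : Fin 3, p (ULift.up i) :=
  ⟨fun h _ => h _, fun h x => h x.down⟩

/-- Equality in `D₃` is decided on the underlying elements of `Fin 3`. -/
theorem eq_D_iff {x y : D.{u} 3} : x = y ↔ ULift.down x = ULift.down y :=
  ULift.down_inj.symm

theorem D_mem_AOL : D.{u} 3 ∈ AOL := by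
  refine ⟨?_, ?_⟩
  · constructor
    · constructor
      · constructor
        · constructor
          all_goals simp only [Below, forall_D, eq_D_iff]; decide
        · simp only [Below, forall_D, eq_D_iff]; decide
      all_goals simp only [Below, forall_D, eq_D_iff]; decide
    all_goals simp only [Below, forall_D, eq_D_iff]; decide
  · ext x
    change x ⊓ kneg x = ⊥ ↔ x = ⊥ ∨ x = ⊤
    revert x
    simp only [forall_D, eq_D_iff]; decide

theorem D_satisfies_SK : Satisfies (D.{u} 3) SK := by
  have h : ∀ x y : D.{u} 3, (x ⊓ dia y) ⊓ (box x ⊔ y) = x ⊓ dia y := by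
    simp only [forall_D, eq_D_iff]; decide
  exact fun v => h (v 0) (v 1)

end PBZ

/-- The variety generated by the three-element antiortholattice chain is the class of models of
the identities of antiortholattices together with `SK`; that is, it is axiomatised relative to
`V(AOL)` by `SK` alone, and `SK` implies `DIST` and `SDM` in `V(AOL)`. -/
theorem corollary3p15 :
    PBZ.V.{u} {PBZ.D.{u} 3} = PBZ.models.{u} (PBZ.identities PBZ.AOL.{u} ∪ {PBZ.SK}) ∧
      PBZ.V.{u} {PBZ.D.{u} 3} = {A | A ∈ PBZ.V PBZ.AOL.{u} ∧ PBZ.Satisfies A PBZ.SK} ∧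
      ∀ A ∈ PBZ.V PBZ.AOL.{u}, PBZ.Satisfies A PBZ.SK →
        PBZ.Satisfies A PBZ.DIST ∧ PBZ.Satisfies A PBZ.SDM := by
  have central : ∀ {A : PBZ.Alg.{u}}, A ∈ PBZ.V PBZ.AOL.{u} → PBZ.IsStarCentral A := fun hA =>
    PBZ.isStarCentral_of_mem_models
      (PBZ.V_subset_models (PBZ.subset_models_identities PBZ.AOL) hA)
  have hD : PBZ.V {PBZ.D.{u} 3} ⊆ PBZ.models (PBZ.identities PBZ.AOL.{u} ∪ {PBZ.SK}) := by
    refine PBZ.V_subset_models ?_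
    rintro _ rfl e (he | rfl)
    · exact he _ PBZ.D_mem_AOL
    · exact PBZ.D_satisfies_SK
  refine ⟨Set.Subset.antisymm hD fun A hA => ?_, Set.Subset.antisymm (fun A hA => ?_) ?_, ?_⟩
  · exact (PBZ.isStarCentral_of_mem_models fun e he => hA e (Or.inl he)).mem_V_D
      (hA _ (Or.inr rfl))
  · refine ⟨PBZ.V_mono ?_ hA, hD hA _ (Or.inr rfl)⟩
    rintro _ rfl W - hW
    exact hW PBZ.D_mem_AOL
  · exact fun A hA => (central hA.1).mem_V_D hA.2
  · exact fun A hA sk => ⟨fun v => (central hA).inf_sup_distrib sk (v 0) (v 1) (v 2),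
      fun v => (central hA).bneg_inf sk (v 0) (v 1)⟩
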